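/- **Conventions.** Graphs are finite; multiple edges and loops are allowed. A *snark* is a $2$-connected cubic graph with no proper $3$-edge-colouring. The *perfect matching index* $\pi(G)$ is the least number of perfect matchings covering all edges of $G$ ($\infty$ if there is no such cover). For real $r\ge 2$, a *nowhere-zero $r$-flow* on $G$ is a real-valued flow $\phi$ (an orientation together with edge values satisfying Kirchhoff's law at every vertex) with $1\le|\phi(e)|\le r-1$ for every edge $e$. The *circular flow number* $\Phi_c(G)$ is the infimum of all real $r\ge 2$ such that $G$ has a nowhere-zero $r$-flow ($\infty$ if there is none). **Halin snarks.** A *cubic Halin graph* $H=C\cup S$ consists of a plane tree $S$, each of whose vertices has degree $1$ or $3$, and a circuit $C$ of length $k\ge 3$ through all the leaves $v_0,\dots,v_{k-1}$ of $S$, in the cyclic order in which they occur along the boundary of the face of $S$. For each $i\in\mathbb Z/k$ choose - a cubic graph $G_i$ with $\pi(G_i)\ge 5$ and adjacent vertices $u_i\neq v^*_i$ of $G_i$. Let $D_i$ be obtained from $G_i$ by removing $u_i$, $v^*_i$ and an edge joining them, and retaining the other edges at $u_i$ (two dangling ends, the input) and at $v^*_i$ (two dangling ends, the output). $D_i$ is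 called a *decollineator*, *obtained from* $G_i$. - a bipartite cubic graph $K_i$ and a path $u'_iw'_iv'_i$ of length $2$ in $K_i$. Let $B_i$ be obtained from $K_i$ by removing this path (its vertices and its two edges) and retaining the dangling ends at $u'_i$ (two, the input), at $v'_i$ (two, the output) and at $w'_i$ (one, the residual end). Join the output of $D_i$ to the input of $B_i$ (the two dangling ends of one are identified with the two of the other, in either way); join the output of $B_i$ to the input of $D_{i+1}$ in the same manner, for all $i$ modulo $k$; and attach the residual end of each $B_i$ to the neighbour of $v_i$ in $S$, where $S$ is taken without its leaves. The resulting cubic graph is called a *Halin snark*. **Theorem.** Let $G$ be a Halin snark in which every decollineator $D_i$ is obtained from a graph $G_i$ that is a snark with $\Phi_c(G_i)\ge 5$. Then $\Phi_c(G)\ge 5$. -/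

import Mathlib

universe u

/-- A finite graph in which multiple edges and loops are allowed. `D` is the type of edge ends
(equivalently, of directed edges): the two ends of an edge are interchanged by `rev`, and the end
`x` is incident with the vertex `base x`. -/
structure Multigraph where
  V : Type u
  D : Type u
  fintypeV : Fintype V
  fintypeD : Fintype D
  rev : D → D
  rev_rev : ∀ x, rev (rev x) = x
  rev_ne : ∀ x, rev x ≠ x
  base : D → V

/-- A multipole: like a graph, except that an edge end need not be incident with a vertex.
The ends `x` with `vert x = none` are the free ends (semiedges). -/
structure Multipole where
  V : Type u
  End : Type u
  rev : End → End
  rev_rev : ∀ x, rev (rev x) = x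
  rev_ne : ∀ x, rev x ≠ x
  vert : End → Option V

namespace Multigraph

attribute [instance] fintypeV fintypeD

variable (G : Multigraph.{u})

/-- Every vertex is incident with exactly three edge ends. -/
def IsCubic : Prop := ∀ v : G.V, Nat.card {x : G.D // G.base x = v} = 3

/-- The two ends of every edge lie in different classes of a bipartition. -/
def IsBipartite : Prop := ∃ c : G.V → Bool, ∀ x, c (G.base x) ≠ c (G.base (G.rev x))

/-- The simple graph in which two distinct vertices are adjacent if some edge joins them. -/
def toSimple : SimpleGraph G.V :=
  SimpleGraph.fromRel fun a b => ∃ x, G.base x = a ∧ G.base (G.rev x) = b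

/-- `2`-connectedness: at least three vertices, connected, and without cut-vertices. -/
def IsTwoConnected : Prop :=
  3 ≤ Fintype.card G.V ∧ G.toSimple.Connected ∧
    ∀ v : G.V, (G.toSimple.induce {v}ᶜ).Connected

/-- A proper edge colouring with three colours: the colour belongs to the edge, and distinct
edge ends at the same vertex have distinct colours. -/
def IsThreeEdgeColourable : Prop :=
  ∃ c : G.D → Fin 3, (∀ x, c (G.rev x) = c x) ∧
    ∀ x y, x ≠ y → G.base x = G.base y → c x ≠ c y

/-- A snark: a `2`-connected cubic graph with no `3`-edge-colouring. -/
def IsSnark : Prop := G.IsCubic ∧ G.IsTwoConnected ∧ ¬ G.IsThreeEdgeColourable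

/-- A perfect matching, given as the set of all ends of its edges. -/
def IsPerfectMatching (M : Set G.D) : Prop :=
  (∀ x ∈ M, G.rev x ∈ M) ∧ ∀ v : G.V, ∃! x, x ∈ M ∧ G.base x = v

/-- The edges can be covered with `n` (not necessarily distinct) perfect matchings. -/
def HasPerfectMatchingCover (n : ℕ) : Prop :=
  ∃ M : Fin n → Set G.D, (∀ j, G.IsPerfectMatching (M j)) ∧ ∀ x, ∃ j, x ∈ M j

/-- The perfect matching index `π(G)`: the smallest number of perfect matchings that cover all
edges (`⊤` if there is no such cover). -/
noncomputable def perfectMatchingIndex : ℕ∞ :=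
  ⨅ (n : ℕ) (_ : G.HasPerfectMatchingCover n), (n : ℕ∞)

open scoped Classical in
/-- An `A`-flow. `φ x` is the value on the edge of `x` when this edge is directed away from the
end `x`, so that reversing the direction changes the sign; Kirchhoff's law holds at each vertex. -/
def IsFlow {A : Type*} [AddCommGroup A] (φ : G.D → A) : Prop :=
  (∀ x, φ (G.rev x) = - φ x) ∧ ∀ v : G.V, ∑ x with G.base x = v, φ x = 0

/-- `G` has a nowhere-zero (real-valued) `r`-flow. -/
def HasNowhereZeroFlow (r : ℝ) : Prop :=
  ∃ φ : G.D → ℝ, G.IsFlow φ ∧ ∀ x, 1 ≤ |φ x| ∧ |φ x| ≤ r - 1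

/-- The circular flow number `Φ_c(G)`: the infimum of all real `r ≥ 2` such that `G` has a
nowhere-zero `r`-flow (`⊤` if there is no such `r`). -/
noncomputable def circularFlowNumber : EReal :=
  ⨅ (r : ℝ) (_ : 2 ≤ r ∧ G.HasNowhereZeroFlow r), (r : EReal)

open scoped Classical in
/-- Remove from `G` the vertices in `P` and the edges with ends in `F`. The other edges are
retained; their ends formerly incident with a vertex of `P` become free. -/
noncomputable def remove (P : Set G.V) (F : Set G.D) (hF : ∀ x ∈ F, G.rev x ∈ F) :
    Multipole.{u} where
  V := {v : G.V // v ∉ P}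
  End := {x : G.D // x ∉ F}
  rev x := ⟨G.rev x, fun h => x.2 (by simpa [G.rev_rev] using hF _ h)⟩
  rev_rev x := Subtype.ext (G.rev_rev x)
  rev_ne x h := G.rev_ne x (congrArg Subtype.val h)
  vert x := if h : G.base x ∈ P then none else some ⟨G.base x, h⟩

end Multigraph

namespace Multipole

/-- Disjoint union of two multipoles. -/
def sum (M N : Multipole.{u}) : Multipole.{u} where
  V := M.V ⊕ N.V
  End := M.End ⊕ N.End
  rev := Sum.map M.rev N.rev
  rev_rev := by rintro (x | x) <;> simp [M.rev_rev, N.rev_rev]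
  rev_ne := by rintro (x | x) <;> simp [M.rev_ne, N.rev_ne]
  vert := Sum.elim (fun x => (M.vert x).map Sum.inl) (fun x => (N.vert x).map Sum.inr)

/-- Disjoint union of a family of multipoles. -/
def sigma {ι : Type} (M : ι → Multipole.{u}) : Multipole.{u} where
  V := Σ i, (M i).V
  End := Σ i, (M i).End
  rev x := ⟨x.1, (M x.1).rev x.2⟩
  rev_rev x := by simp [(M x.1).rev_rev]
  rev_ne := by
    rintro ⟨i, x⟩ h
    simp only [Sigma.mk.injEq, heq_eq_eq, true_and] at h
    exact (M i).rev_ne x h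
  vert x := ((M x.1).vert x.2).map (Sigma.mk x.1)

/-- `M.YieldsByJunctions J Γ`: the graph `Γ` arises from the multipole `M` by performing, for all
`x`, `y` with `J x y`, the junction of the free ends `x` and `y`. It is applied to relations `J`
that pair up all the free ends of `M`.

The vertices of `Γ` are those of `M`. Every edge of `M`, directed away from its end `x`, becomes
a part of one directed edge `dir x` of `Γ`. Directing an edge away from `x` or away from `rev x`
gives opposite directions. If the free ends `x` and `y` are joined, their edges become parts of
one edge, in which "away from `x`" and "away from `y`" are opposite directions.
The ends of the edges of `Γ` are those ends of `M` that are incident with a vertex, with the same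
incidences. (An edge with two free ends may also take part in junctions.) -/
def YieldsByJunctions (M : Multipole.{u}) (J : M.End → M.End → Prop) (Γ : Multigraph.{u}) : Prop :=
  ∃ (vtx : M.V ≃ Γ.V) (dir : M.End → Γ.D),
    (∀ x, dir (M.rev x) = Γ.rev (dir x)) ∧
    (∀ x y, J x y → dir y = Γ.rev (dir x)) ∧
    (∀ x v, M.vert x = some v → Γ.base (dir x) = vtx v) ∧
    ∀ d : Γ.D, ∃! x, M.vert x ≠ none ∧ dir x = d

end Multipole

/-- A cubic Halin graph `H = C ∪ S`. The plane tree `S` is given by a tree in which every vertex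
has degree `1` or `3` together with a rotation `rot` (the cyclic order of the edges around each
vertex). The perimeter circuit `C` runs through all the leaves `leaf 0, …, leaf (k - 1)` of `S`
in the cyclic order in which they occur along the boundary of the unique face of `S`. -/
structure CubicHalinGraph where
  T : Type u
  fintypeT : Fintype T
  /-- The inscribed tree. -/
  S : SimpleGraph T
  isTree : S.IsTree
  degree_eq : ∀ t, (S.neighborSet t).ncard = 1 ∨ (S.neighborSet t).ncard = 3
  rot : Equiv.Perm S.Dart
  rot_fst : ∀ d, (rot d).fst = d.fst
  rot_sameCycle : ∀ d d' : S.Dart, d.fst = d'.fst → rot.SameCycle d d'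
  /-- The length of the perimeter circuit. -/
  k : ℕ
  three_le : 3 ≤ k
  leaf : Fin k ≃ {t : T // (S.neighborSet t).ncard = 1}
  /-- Tracing the face of the plane tree `S` (having traversed `d`, continue with the edge that
  follows `d.symm` in the rotation) from `leaf i`, the next leaf met is `leaf (i + 1)`. -/
  leaf_next : ∀ i : Fin k, ∃ d : S.Dart, d.fst = leaf i ∧ ∃ n : ℕ, 0 < n ∧
    ((fun d : S.Dart => rot d.symm)^[n] d).fst = leaf (finRotate k i) ∧
    ∀ m, 0 < m → m < n →
      (S.neighborSet ((fun d : S.Dart => rot d.symm)^[m] d).fst).ncard ≠ 1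

namespace CubicHalinGraph

variable (H : CubicHalinGraph.{u})

/-- The vertex `t` is a leaf of the inscribed tree. -/
def IsLeaf (t : H.T) : Prop := (H.S.neighborSet t).ncard = 1

open scoped Classical in
/-- The multipole obtained from the inscribed tree by removing the leaves and retaining the
dangling edges. -/
noncomputable def innerTree : Multipole.{u} where
  V := {t : H.T // ¬ H.IsLeaf t}
  End := H.S.Dart
  rev := SimpleGraph.Dart.symm
  rev_rev := SimpleGraph.Dart.symm_symm
  rev_ne := SimpleGraph.Dart.symm_ne
  vert d := if h : H.IsLeaf d.fst then none else some ⟨d.fst, h⟩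

end CubicHalinGraph

/-- The constituents of a Halin fragment `F = D ∘ B`: a cubic graph `G` with `π(G) ≥ 5` and an
edge `uv` of `G` (with end `e` at `u` and the other end at `v`), which give the decollineator
`D = G_{uv}`; a bipartite cubic graph `K` and a path `u'w'v'` in `K` (with edges given by their
ends `f` at `u'` and `g` at `w'`), which give the bipartite `(2,2;1)`-pole `B = K_{u'w'v'}`. The
junction of the output connector of `D` with the input connector of `B` is described by `join`. -/
structure HalinFragment where
  G : Multigraph.{u}
  G_cubic : G.IsCubic
  five_le_index : 5 ≤ G.perfectMatchingIndex
  e : G.D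
  u_ne_v : G.base e ≠ G.base (G.rev e)
  K : Multigraph.{u}
  K_cubic : K.IsCubic
  K_bipartite : K.IsBipartite
  f : K.D
  g : K.D
  path : K.base (K.rev f) = K.base g
  u'_ne_v' : K.base f ≠ K.base (K.rev g)
  join : {x : G.D // x ∉ ({e, G.rev e} : Set G.D) ∧ G.base x = G.base (G.rev e)} ≃
    {y : K.D // y ∉ ({f, K.rev f, g, K.rev g} : Set K.D) ∧ K.base y = K.base f}

namespace HalinFragment

variable (F : HalinFragment.{u})

/-- The ends of the edge `uv` removed from `G`. -/
def removedG : Set F.G.D := {F.e, F.G.rev F.e}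

/-- The ends of the two edges of the path `u'w'v'` removed from `K`. -/
def removedK : Set F.K.D := {F.f, F.K.rev F.f, F.g, F.K.rev F.g}

/-- The decollineator `D = G_{uv}`. -/
noncomputable def decollineator : Multipole.{u} :=
  F.G.remove {F.G.base F.e, F.G.base (F.G.rev F.e)} F.removedG
    (by rintro x (rfl | rfl) <;> simp [removedG, F.G.rev_rev])

/-- The bipartite `(2,2;1)`-pole `B = K_{u'w'v'}`. -/
noncomputable def bipartitePole : Multipole.{u} :=
  F.K.remove {F.K.base F.f, F.K.base F.g, F.K.base (F.K.rev F.g)} F.removedK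
    (by rintro x (rfl | rfl | rfl | rfl) <;> simp [removedK, F.K.rev_rev])

/-- The input connector of `D` and of `F`: the semiedges formerly incident with `u`. -/
abbrev Input : Type u := {x : F.G.D // x ∉ F.removedG ∧ F.G.base x = F.G.base F.e}

/-- The output connector of `D`: the semiedges formerly incident with `v`. -/
abbrev MiddleOut : Type u :=
  {x : F.G.D // x ∉ F.removedG ∧ F.G.base x = F.G.base (F.G.rev F.e)}

/-- The output connector of `B` and of `F`: the semiedges formerly incident with `v'`. -/
abbrev Output : Type u :=
  {y : F.K.D // y ∉ F.removedK ∧ F.K.base y = F.K.base (F.K.rev F.g)}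

/-- The residual semiedge of `B` and of `F`: the one formerly incident with `w'`. -/
abbrev Residual : Type u := {y : F.K.D // y ∉ F.removedK ∧ F.K.base y = F.K.base F.g}

end HalinFragment

/-- The data from which a Halin snark is constructed: a cubic Halin graph `H`, a Halin fragment
`F i` for each vertex `leaf i` of the perimeter circuit, and, for each `i` modulo `k`, the way in
which the output connector of `F i` is joined to the input connector of `F (i + 1)`. -/
structure HalinConstruction where
  H : CubicHalinGraph.{u}
  F : Fin H.k → HalinFragment.{u}
  join : ∀ i, (F i).Output ≃ (F (finRotate H.k i)).Input

namespace HalinConstruction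

variable (A : HalinConstruction.{u})

/-- The disjoint union of all the decollineators, all the bipartite `(2,2;1)`-poles, and the tree
`S` without its leaves. -/
noncomputable def parts : Multipole.{u} :=
  (Multipole.sigma fun i => (A.F i).decollineator).sum
    ((Multipole.sigma fun i => (A.F i).bipartitePole).sum A.H.innerTree)

/-- An edge end of the `i`-th decollineator, as an edge end of the disjoint union. -/
noncomputable def inD (i : Fin A.H.k) (x : (A.F i).G.D) (hx : x ∉ (A.F i).removedG) :
    A.parts.End :=
  Sum.inl ⟨i, ⟨x, hx⟩⟩

/-- An edge end of the `i`-th bipartite pole, as an edge end of the disjoint union. -/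
noncomputable def inB (i : Fin A.H.k) (y : (A.F i).K.D) (hy : y ∉ (A.F i).removedK) :
    A.parts.End :=
  Sum.inr (Sum.inl ⟨i, ⟨y, hy⟩⟩)

/-- An edge end of the tree, as an edge end of the disjoint union. -/
noncomputable def inS (d : A.H.S.Dart) : A.parts.End := Sum.inr (Sum.inr d)

/-- The junctions that are performed in the construction of the Halin snark. -/
inductive Junction : A.parts.End → A.parts.End → Prop
  /-- The output connector of `D i` is joined to the input connector of `B i`. -/
  | fragment (i : Fin A.H.k) (x : (A.F i).MiddleOut) :
      Junction (A.inD i x x.2.1) (A.inB i ((A.F i).join x) ((A.F i).join x).2.1)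
  /-- The output connector of `F i` is joined to the input connector of `F (i + 1)`. -/
  | perimeter (i : Fin A.H.k) (y : (A.F i).Output) :
      Junction (A.inB i y y.2.1) (A.inD (finRotate A.H.k i) (A.join i y) (A.join i y).2.1)
  /-- The residual semiedge of `F i` is attached to the neighbour in `S` of `leaf i`, that is,
  it is joined to the free end left by the removal of `leaf i`. -/
  | residual (i : Fin A.H.k) (y : (A.F i).Residual) (d : A.H.S.Dart)
      (hd : d.fst = A.H.leaf i) : Junction (A.inB i y y.2.1) (A.inS d)

/-- `Γ` is (isomorphic to) the Halin snark constructed from the given data. -/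
def Yields (Γ : Multigraph.{u}) : Prop := A.parts.YieldsByJunctions A.Junction Γ

end HalinConstruction

/-! Suppose that the Halin snark has a nowhere-zero `r`-flow with `r < 5`, and let `X i` be the
total flow through the decollineator `D i`. As `G i` has no nowhere-zero `r`-flow, `X i` is at
distance less than 1 from some multiple of `r` (`exists_abs_outflow_sub_lt_one`): otherwise the
deleted edge could be restored with a value congruent to `X i` modulo `r` up to sign, and the
resulting flow modulo `r` would lift to a real one (`hasNowhereZeroFlow_of_defect`).

By conservation the residual edge of the `i`-th fragment carries `X (i+1) - X i` (`residual_value`).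
Some inner vertex of the tree is adjacent to two leaves, and these are consecutive on the perimeter
(`exists_darts_to_consecutive_leaves`). The three edges at this vertex therefore carry, up to sign,
the differences of `X i`, `X (i+1)`, `X (i+2)`. Flow values stay at distance at least 1 from all
multiples of `r` (`one_le_abs_sub_int_mul`), so subtracting suitable multiples of `r` from the three
totals leaves three numbers in the open interval (-1, 1) that are pairwise at least 1 apart, which
is impossible. -/

/-! ### Flows with defects at two vertices, and their repair. -/

namespace Multigraph

variable (G : Multigraph.{u})

open scoped Classical in
/-- The net outflow at a vertex of a function on the edge ends. -/
noncomputable def outflow (φ : G.D → ℝ) (v : G.V) : ℝ := ∑ x with G.base x = v, φ x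

/-- Reduce by `c` the value on the edge of `x`, directed away from `x`. -/
noncomputable def shift (φ : G.D → ℝ) (x : G.D) (c : ℝ) (y : G.D) : ℝ :=
  open scoped Classical in
  φ y - (if y = x then c else 0) + (if y = G.rev x then c else 0)

variable {G}

theorem rev_eq_iff {x y : G.D} : G.rev x = y ↔ x = G.rev y :=
  ⟨fun h => by rw [← h, G.rev_rev], fun h => by rw [h, G.rev_rev]⟩

theorem shift_rev {φ : G.D → ℝ} (h : ∀ x, φ (G.rev x) = -φ x) (x : G.D) (c : ℝ) (y : G.D) :
    G.shift φ x c (G.rev y) = -G.shift φ x c y := by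
  classical
  have h1 : (G.rev y = x) ↔ (y = G.rev x) := rev_eq_iff
  have h2 : (G.rev y = G.rev x) ↔ (y = x) := by rw [rev_eq_iff, G.rev_rev]
  simp only [shift, h, h1, h2]
  ring

theorem shift_self (φ : G.D → ℝ) (x : G.D) (c : ℝ) : G.shift φ x c x = φ x - c := by
  simp [shift, (G.rev_ne x).symm]

theorem shift_of_ne (φ : G.D → ℝ) {x y : G.D} (c : ℝ) (h : y ≠ x) (h' : y ≠ G.rev x) :
    G.shift φ x c y = φ y := by
  simp [shift, h, h']

open scoped Classical in
theorem outflow_shift (φ : G.D → ℝ) (x : G.D) (c : ℝ) (v : G.V) :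
    G.outflow (G.shift φ x c) v = G.outflow φ v - (if v = G.base x then c else 0)
      + (if v = G.base (G.rev x) then c else 0) := by
  simp only [outflow, shift, Finset.sum_add_distrib, Finset.sum_sub_distrib,
    Finset.sum_ite_eq', Finset.mem_filter, Finset.mem_univ, true_and]
  simp only [eq_comm (a := v)]

theorem abs_shift_bounds {φ : G.D → ℝ} (h : ∀ x, φ (G.rev x) = -φ x) (x : G.D) (c a b : ℝ)
    (hφ : ∀ y, y ≠ x → y ≠ G.rev x → a ≤ |φ y| ∧ |φ y| ≤ b)
    (hx : a ≤ |φ x - c| ∧ |φ x - c| ≤ b) (y : G.D) :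
    a ≤ |G.shift φ x c y| ∧ |G.shift φ x c y| ≤ b := by
  by_cases h1 : y = x
  · rw [h1, shift_self]; exact hx
  by_cases h2 : y = G.rev x
  · rw [h2, shift_rev h, shift_self, abs_neg]; exact hx
  · rw [shift_of_ne φ c h1 h2]; exact hφ y h1 h2

theorem sum_eq_zero_of_antisymm {φ : G.D → ℝ} (h : ∀ x, φ (G.rev x) = -φ x)
    (s : Finset G.D) (hs : ∀ x ∈ s, G.rev x ∈ s) : ∑ x ∈ s, φ x = 0 := by
  have : ∑ x ∈ s, φ x = ∑ x ∈ s, φ (G.rev x) :=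
    Finset.sum_nbij' G.rev G.rev hs hs (fun x _ => G.rev_rev x) (fun x _ => G.rev_rev x)
      (fun x _ => by rw [G.rev_rev])
  simp only [h, Finset.sum_neg_distrib] at this
  linarith

open scoped Classical in
theorem sum_outflow (φ : G.D → ℝ) (s : Finset G.V) :
    ∑ v ∈ s, G.outflow φ v = ∑ x with G.base x ∈ s, φ x := by
  rw [← Finset.sum_fiberwise_of_maps_to (t := s) (g := G.base) (by simp)]
  refine Finset.sum_congr rfl fun v hv => ?_
  rw [outflow, Finset.filter_filter]
  refine Finset.sum_congr ?_ fun _ _ => rfl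
  ext x
  simp only [Finset.mem_filter, Finset.mem_univ, true_and]
  exact ⟨fun h => ⟨h ▸ hv, h⟩, fun h => h.2⟩

theorem sum_outflow_univ {φ : G.D → ℝ} (h : ∀ x, φ (G.rev x) = -φ x) :
    ∑ v, G.outflow φ v = 0 := by
  classical
  rw [sum_outflow]
  exact sum_eq_zero_of_antisymm h _ (by simp)

/-- The net outflow of a set that no positive edge leaves is not positive. -/
theorem sum_outflow_nonpos {φ : G.D → ℝ} (h : ∀ x, φ (G.rev x) = -φ x) (s : Finset G.V)
    (hs : ∀ x, G.base x ∈ s → 0 < φ x → G.base (G.rev x) ∈ s) :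
    ∑ v ∈ s, G.outflow φ v ≤ 0 := by
  classical
  -- Edges inside `s` cancel; only the ends whose edge leaves `s` contribute.
  rw [sum_outflow, ← Finset.sum_filter_add_sum_filter_not _ fun x => G.base (G.rev x) ∈ s,
    sum_eq_zero_of_antisymm h, zero_add]
  · refine Finset.sum_nonpos fun x hx => ?_
    simp only [Finset.mem_filter, Finset.mem_univ, true_and] at hx
    exact not_lt.1 fun hlt => hx.2 (hs x hx.1 hlt)
  · intro x hx
    simp only [Finset.mem_filter, Finset.mem_univ, true_and, G.rev_rev] at hx ⊢
    exact ⟨hx.2, hx.1⟩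

/-- There is a directed walk of length `n` from `v` to `t` along edges with positive value. -/
def PositiveWalk (φ : G.D → ℝ) (t : G.V) : ℕ → G.V → Prop
  | 0, v => v = t
  | n + 1, v => ∃ x, G.base x = v ∧ 0 < φ x ∧ PositiveWalk φ t n (G.base (G.rev x))

-- Otherwise the vertices that cannot reach `t` form a set containing `s` but not `t`. No positive
-- edge leaves it, yet its net outflow is `r > 0`.
open scoped Classical in
theorem exists_positiveWalk {φ : G.D → ℝ} (h : ∀ x, φ (G.rev x) = -φ x) {r : ℝ} (hr : 0 < r)
    {s t : G.V}
    (hout : ∀ v, G.outflow φ v = (if v = s then r else 0) - (if v = t then r else 0)) :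
    ∃ n, PositiveWalk φ t n s := by
  by_contra hs
  have key := sum_outflow_nonpos h {v | ¬ ∃ n, PositiveWalk φ t n v} (by
    simp only [Finset.mem_filter, Finset.mem_univ, true_and]
    rintro x hx hpos ⟨n, hn⟩
    exact hx ⟨n + 1, x, rfl, hpos, hn⟩)
  have ht : ∃ n, PositiveWalk φ t n t := ⟨0, rfl⟩
  simp only [hout, Finset.sum_sub_distrib, Finset.sum_ite_eq', Finset.mem_filter,
    Finset.mem_univ, true_and, hs, ht, not_true, not_false_eq_true, if_true, if_false] at key
  linarith

theorem hasNowhereZeroFlow_of_outflow {φ : G.D → ℝ} (h : ∀ x, φ (G.rev x) = -φ x) {r : ℝ}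
    (hb : ∀ x, 1 ≤ |φ x| ∧ |φ x| ≤ r - 1) (hout : ∀ v, G.outflow φ v = 0) :
    G.HasNowhereZeroFlow r :=
  ⟨φ, ⟨h, hout⟩, hb⟩

open scoped Classical in
/-- A flow that violates Kirchhoff's law only at two vertices, by `r` and `-r`, can be turned into
a flow by replacing the value `z` by `z - r` along a directed path. -/
theorem hasNowhereZeroFlow_of_defect {φ : G.D → ℝ} (h : ∀ x, φ (G.rev x) = -φ x) {r : ℝ}
    (hr : 0 < r) (hb : ∀ x, 1 ≤ |φ x| ∧ |φ x| ≤ r - 1) {s t : G.V}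
    (hout : ∀ v, G.outflow φ v = (if v = s then r else 0) - (if v = t then r else 0)) :
    G.HasNowhereZeroFlow r := by
  -- Distance to `t` along positive edges. It takes the default value 0 where `t` is unreachable, so
  -- reachability is carried separately below.
  let ρ : G.V → ℕ := fun v => sInf {n | PositiveWalk φ t n v}
  have step : ∀ n v, ρ v = n + 1 →
      ∃ x, G.base x = v ∧ 0 < φ x ∧ ρ (G.base (G.rev x)) = n ∧
        ∃ m, PositiveWalk φ t m (G.base (G.rev x)) := by
    intro n v hv
    have hne : {n | PositiveWalk φ t n v}.Nonempty :=
      Nat.nonempty_of_pos_sInf (by change 0 < ρ v; omega)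
    have hmem : PositiveWalk φ t (n + 1) v := hv ▸ Nat.sInf_mem hne
    obtain ⟨x, hx, hpos, hw⟩ := hmem
    refine ⟨x, hx, hpos, le_antisymm (Nat.sInf_le hw) ?_, n, hw⟩
    have h1 : PositiveWalk φ t (ρ (G.base (G.rev x))) (G.base (G.rev x)) :=
      Nat.sInf_mem (s := {n | PositiveWalk φ t n (G.base (G.rev x))}) ⟨n, hw⟩
    have h2 : ρ v ≤ ρ (G.base (G.rev x)) + 1 := Nat.sInf_le ⟨x, hx, hpos, h1⟩
    omega
  -- The excess `r` has been pushed to `w` along a shortest path. Every edge altered so far has an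
  -- end with `ρ > n`, so the edges still to be used keep their original positive values.
  have main : ∀ (n : ℕ) (ψ : G.D → ℝ) (w : G.V), ρ w = n → (∃ m, PositiveWalk φ t m w) →
      (∀ x, ψ (G.rev x) = -ψ x) → (∀ x, 1 ≤ |ψ x| ∧ |ψ x| ≤ r - 1) →
      (∀ v, G.outflow ψ v = (if v = w then r else 0) - (if v = t then r else 0)) →
      (∀ x, ρ (G.base x) ≤ n → ρ (G.base (G.rev x)) ≤ n → ψ x = φ x) →
      G.HasNowhereZeroFlow r := by
    intro n
    induction n with
    | zero =>
      intro ψ w hw hreach hψ hbψ hoψ _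
      have hwt : w = t := by
        have : PositiveWalk φ t (ρ w) w :=
          Nat.sInf_mem (s := {n | PositiveWalk φ t n w}) hreach
        rwa [hw] at this
      exact hasNowhereZeroFlow_of_outflow hψ hbψ fun v => by rw [hoψ, hwt, sub_self]
    | succ n ih =>
      intro ψ w hw hreach hψ hbψ hoψ hag
      obtain ⟨x, hx, hpos, hρ, hreach'⟩ := step n w hw
      have hψx : ψ x = φ x := hag x (by rw [hx, hw]) (by omega)
      have hxr : 0 < ψ x := hψx ▸ hpos
      refine ih (G.shift ψ x r) _ hρ hreach' (shift_rev hψ x r) ?_ ?_ ?_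
      · refine abs_shift_bounds hψ x r 1 (r - 1) (fun y _ _ => hbψ y) ?_
        have := hbψ x
        rw [abs_of_pos hxr] at this
        rw [abs_of_neg (by linarith)]
        constructor <;> linarith
      · intro v
        rw [outflow_shift, hoψ, hx]
        ring
      · intro y hy hy'
        rw [shift_of_ne]
        · exact hag y (by omega) (by omega)
        · rintro rfl
          rw [hx] at hy
          omega
        · rintro rfl
          rw [G.rev_rev, hx] at hy'
          omega
  exact main (ρ s) φ s rfl (exists_positiveWalk h hr hout) h hb hout fun _ _ _ => rfl

/-- If a cubic graph has no nowhere-zero `r`-flow, then after the removal of an edge `uv` the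
total value of a flow through the remaining edges at `u` is close to a multiple of `r`. -/
theorem exists_abs_outflow_sub_lt_one (hG : G.IsCubic) {e : G.D}
    (huv : G.base e ≠ G.base (G.rev e)) {r : ℝ} (hr : 2 ≤ r) (hno : ¬ G.HasNowhereZeroFlow r)
    {ψ : G.D → ℝ} (h : ∀ x, ψ (G.rev x) = -ψ x) (he : ψ e = 0)
    (hb : ∀ x, x ≠ e → x ≠ G.rev e → 1 ≤ |ψ x| ∧ |ψ x| ≤ r - 1)
    (hout : ∀ v, v ≠ G.base e → v ≠ G.base (G.rev e) → G.outflow ψ v = 0) :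
    ∃ m : ℤ, |G.outflow ψ (G.base e) - m * r| < 1 := by
  classical
  by_contra! hcon
  set X := G.outflow ψ (G.base e) with hX
  have hv : G.outflow ψ (G.base (G.rev e)) = -X := by
    have := sum_outflow_univ h
    rw [Fintype.sum_eq_add _ _ huv fun v hv => hout v hv.1 hv.2] at this
    linarith
  -- The edge `e` is restored with value `-c`; the defect `X - c` remains at its two ends.
  have hshift : ∀ c v, G.outflow (G.shift ψ e c) v =
      (if v = G.base e then X - c else 0) - (if v = G.base (G.rev e) then X - c else 0) := by
    intro c v
    rw [outflow_shift]
    by_cases h1 : v = G.base e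
    · subst h1
      simp [huv, hX]
    by_cases h2 : v = G.base (G.rev e)
    · subst h2
      simp only [hv, h1, if_true, if_false]
      ring
    · simp [h1, h2, hout v h1 h2]
  have hbd : ∀ c, 1 ≤ |c| → |c| ≤ r - 1 → ∀ x,
      1 ≤ |G.shift ψ e c x| ∧ |G.shift ψ e c x| ≤ r - 1 := fun c h1 h2 =>
    abs_shift_bounds h e c 1 (r - 1) hb (by rw [he, zero_sub, abs_neg]; exact ⟨h1, h2⟩)
  -- By cubicity only two ends other than `e` remain at `u`. This bound is why the multiples `0`,
  -- `r` and `-r` suffice.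
  have hXle : |X| ≤ 2 * (r - 1) := by
    have hcard : (Finset.univ.filter fun x => G.base x = G.base e).card = 3 := by
      rw [← hG (G.base e), Nat.card_eq_fintype_card, Fintype.card_subtype]
    have hmem : e ∈ Finset.univ.filter fun x => G.base x = G.base e := by simp
    have h1 : X = ∑ x ∈ (Finset.univ.filter fun x => G.base x = G.base e).erase e, ψ x := by
      rw [Finset.sum_erase _ he]; rfl
    rw [h1]
    refine (Finset.abs_sum_le_sum_abs _ _).trans ?_
    refine (Finset.sum_le_card_nsmul _ _ (r - 1) fun x hx => ?_).trans ?_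
    · simp only [Finset.mem_erase, Finset.mem_filter, Finset.mem_univ, true_and] at hx
      exact (hb x hx.1 fun hxe => huv (by rw [← hx.2, hxe])).2
    · rw [Finset.card_erase_of_mem hmem, hcard]
      simp
  have h0 := hcon 0
  have h1 := hcon 1
  have h2 := hcon (-1)
  push_cast at h0 h1 h2
  rw [zero_mul, sub_zero] at h0
  -- Small `X` is itself admissible on `e`; otherwise `X - r` or `X + r` is, leaving a defect of
  -- exactly `r` to be repaired.
  rcases le_or_gt (|X|) (r - 1) with hle | hlt
  · exact hno (hasNowhereZeroFlow_of_outflow (shift_rev h e X) (hbd X h0 hle) fun v => by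
      simp [hshift])
  rcases abs_cases X with ⟨ha, hs⟩ | ⟨ha, hs⟩
  · refine hno (hasNowhereZeroFlow_of_defect (shift_rev h e (X - r)) (by linarith)
      (hbd _ (by simpa using h1) (abs_le.2 ⟨?_, ?_⟩)) (s := G.base e) (t := G.base (G.rev e))
      fun v => ?_)
    · linarith
    · linarith
    · rw [hshift, sub_sub_cancel]
  · refine hno (hasNowhereZeroFlow_of_defect (shift_rev h e (X + r)) (by linarith)
      (hbd _ (by simpa using h2) (abs_le.2 ⟨?_, ?_⟩)) (s := G.base (G.rev e)) (t := G.base e)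
      fun v => ?_)
    · linarith
    · linarith
    · rw [hshift]
      split_ifs <;> ring

end Multigraph

/-! ### Leaves of the inscribed tree and their order on the perimeter. -/

namespace CubicHalinGraph

variable (H : CubicHalinGraph.{u})

theorem dart_eq_of_isLeaf {d d' : H.S.Dart} (h : H.IsLeaf d.fst) (hd : d'.fst = d.fst) :
    d' = d := by
  obtain ⟨a, ha⟩ := Set.ncard_eq_one.1 h
  have h1 : d.snd ∈ H.S.neighborSet d.fst := d.adj
  have h2 : d'.snd ∈ H.S.neighborSet d.fst := hd ▸ d'.adj
  rw [ha, Set.mem_singleton_iff] at h1 h2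
  exact SimpleGraph.Dart.ext _ _ (Prod.ext hd (h2.trans h1.symm))

theorem card_leaves : Nat.card {t // H.IsLeaf t} = H.k := by
  have := Nat.card_congr H.leaf
  rw [Nat.card_fin] at this
  exact this.symm

/-- Two adjacent leaves would be a whole component, hence the whole tree, which has at least three
leaves. -/
theorem not_isLeaf_of_adj {a b : H.T} (hab : H.S.Adj a b) (ha : H.IsLeaf a) : ¬ H.IsLeaf b := by
  intro hb
  have hclosed : ∀ x y, H.S.Adj x y → (x = a ∨ x = b) → (y = a ∨ y = b) := by
    rintro x y hxy (rfl | rfl)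
    · have := H.dart_eq_of_isLeaf (d := ⟨(x, b), hab⟩) (d' := ⟨(x, y), hxy⟩) ha rfl
      simp only [SimpleGraph.Dart.mk.injEq, Prod.mk.injEq, true_and] at this
      exact Or.inr this
    · have := H.dart_eq_of_isLeaf (d := ⟨(x, a), hab.symm⟩) (d' := ⟨(x, y), hxy⟩) hb rfl
      simp only [SimpleGraph.Dart.mk.injEq, Prod.mk.injEq, true_and] at this
      exact Or.inl this
  have hwalk : ∀ x y, H.S.Walk x y → (x = a ∨ x = b) → (y = a ∨ y = b) := by
    intro x y p
    induction p with
    | nil => exact id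
    | cons hadj _ ih => exact fun hx => ih (hclosed _ _ hadj hx)
  have hall : ∀ y, y = a ∨ y = b := fun y =>
    (H.isTree.connected.preconnected a y).elim fun p => hwalk a y p (Or.inl rfl)
  have hle : Nat.card {t // H.IsLeaf t} ≤ Nat.card Bool := by
    classical
    refine Nat.card_le_card_of_injective (fun t => decide (t.1 = a)) fun s t hst => ?_
    simp only [decide_eq_decide] at hst
    apply Subtype.ext
    rcases hall s with h | h <;> rcases hall t with h' | h' <;> grind
  rw [H.card_leaves, Nat.card_eq_fintype_card, Fintype.card_bool] at hle
  have := H.three_le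
  omega

/-- There are two more leaves than inner vertices. -/
theorem card_leaves_eq :
    Nat.card {t // H.IsLeaf t} = Nat.card {t // ¬ H.IsLeaf t} + 2 := by
  classical
  let := H.fintypeT
  have hE := H.isTree.card_edgeFinset
  have hS := H.S.sum_degrees_eq_twice_card_edges
  have hdeg : ∀ t, H.S.degree t = if H.IsLeaf t then 1 else 3 := by
    intro t
    rw [← H.S.card_neighborSet_eq_degree, ← Nat.card_eq_fintype_card, Nat.card_coe_set_eq]
    split_ifs with h
    · exact h
    · exact (H.degree_eq t).resolve_left h
  simp only [hdeg, Finset.sum_ite, Finset.sum_const, smul_eq_mul, mul_one] at hS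
  have hc := Finset.card_filter_add_card_filter_not (s := (Finset.univ : Finset H.T))
    fun t => H.IsLeaf t
  rw [Finset.card_univ] at hc
  rw [Nat.subtype_card (Finset.univ.filter fun t => H.IsLeaf t) (by simp),
    Nat.subtype_card (Finset.univ.filter fun t => ¬ H.IsLeaf t) (by simp)]
  -- With `L` leaves and `I` inner vertices, the degree sum gives `L + 3 I = 2 (L + I - 1)`.
  omega

/-- Some inner vertex has two neighbours that are leaves. -/
theorem exists_darts_to_leaves : ∃ d d' : H.S.Dart, d ≠ d' ∧ d.fst = d'.fst ∧
    ¬ H.IsLeaf d.fst ∧ H.IsLeaf d.snd ∧ H.IsLeaf d'.snd := by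
  let := H.fintypeT
  have hnb : ∀ t : {t // H.IsLeaf t}, ∃ s, H.S.Adj t s := by
    intro t
    obtain ⟨a, ha⟩ := Set.ncard_eq_one.1 t.2
    exact ⟨a, by rw [← SimpleGraph.mem_neighborSet, ha]; rfl⟩
  choose nb hnb using hnb
  let f : {t // H.IsLeaf t} → {t // ¬ H.IsLeaf t} := fun t =>
    ⟨nb t, H.not_isLeaf_of_adj (hnb t) t.2⟩
  -- Pigeonhole: the leaves outnumber the inner vertices.
  have hf : ¬ Function.Injective f := fun hinj => by
    have := Nat.card_le_card_of_injective f hinj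
    rw [H.card_leaves_eq] at this
    omega
  simp only [Function.Injective, not_forall] at hf
  obtain ⟨s, t, hst, hne⟩ := hf
  have hst' : nb s = nb t := congrArg Subtype.val hst
  refine ⟨⟨(nb s, s), (hnb s).symm⟩, ⟨(nb t, t), (hnb t).symm⟩, ?_, hst', (f s).2, s.2, t.2⟩
  intro h
  simp only [SimpleGraph.Dart.mk.injEq, Prod.mk.injEq] at h
  exact hne (Subtype.ext h.2)

theorem exists_third_dart {d d' : H.S.Dart} (hne : d ≠ d') (hfst : d.fst = d'.fst)
    (hl : ¬ H.IsLeaf d.fst) : ∃ d'' : H.S.Dart, d'' ≠ d ∧ d'' ≠ d' ∧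
      ∀ x : H.S.Dart, x.fst = d.fst ↔ x = d ∨ x = d' ∨ x = d'' := by
  have h3 := (H.degree_eq d.fst).resolve_left hl
  obtain ⟨a, b, c, hab, hac, hbc, habc⟩ := Set.ncard_eq_three.1 h3
  have hmem : ∀ y, H.S.Adj d.fst y ↔ y = a ∨ y = b ∨ y = c := by
    intro y
    rw [← SimpleGraph.mem_neighborSet, habc]
    simp
  have hd := (hmem d.snd).1 d.adj
  have hd' := (hmem d'.snd).1 (hfst ▸ d'.adj)
  have hsnd : ∀ x y : H.S.Dart, x.fst = d.fst → y.fst = d.fst → (x = y ↔ x.snd = y.snd) :=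
    fun x y hx hy => ⟨fun h => h ▸ rfl, fun h =>
      SimpleGraph.Dart.ext _ _ (Prod.ext (hx.trans hy.symm) h)⟩
  have hdd : d.snd ≠ d'.snd := fun h => hne ((hsnd d d' rfl hfst.symm).2 h)
  obtain ⟨z, hz, hzd, hzd'⟩ : ∃ z, H.S.Adj d.fst z ∧ z ≠ d.snd ∧ z ≠ d'.snd := by
    have ha := (hmem a).2 (by simp)
    have hb := (hmem b).2 (by simp)
    have hc := (hmem c).2 (by simp)
    by_contra! hcon
    have h1 := hcon a ha
    have h2 := hcon b hb
    have h3 := hcon c hc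
    grind
  refine ⟨⟨(d.fst, z), hz⟩, ?_, ?_, fun x => ⟨fun hx => ?_, ?_⟩⟩
  · exact fun h => hzd ((hsnd ⟨(d.fst, z), hz⟩ d rfl rfl).1 h)
  · exact fun h => hzd' ((hsnd ⟨(d.fst, z), hz⟩ d' rfl hfst.symm).1 h)
  · rw [hsnd x d hx rfl, hsnd x d' hx hfst.symm, hsnd x ⟨(d.fst, z), hz⟩ hx rfl]
    have hx' := (hmem x.snd).1 (hx ▸ x.adj)
    have hz' := (hmem z).1 hz
    change x.snd = d.snd ∨ x.snd = d'.snd ∨ x.snd = z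
    grind
  · rintro (rfl | rfl | rfl)
    · rfl
    · exact hfst.symm
    · rfl

/-- The rotation at an inner vertex is a 3-cycle, so of any two darts there one follows the other.
-/
theorem rot_eq_or_rot_eq {d d' : H.S.Dart} (hne : d ≠ d') (hfst : d.fst = d'.fst)
    (hl : ¬ H.IsLeaf d.fst) : H.rot d = d' ∨ H.rot d' = d := by
  obtain ⟨d'', hd, hd', hall⟩ := H.exists_third_dart hne hfst hl
  have hfix : ∀ x y : H.S.Dart, x.fst = y.fst → x ≠ y → H.rot x ≠ x := fun x y hxy hxy' hrot =>
    hxy' ((H.rot_sameCycle x y hxy).eq_of_left hrot)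
  have h1 := (hall (H.rot d)).1 (H.rot_fst d)
  have h2 := (hall (H.rot d')).1 ((H.rot_fst d').trans hfst.symm)
  have h3 := hfix d d' hfst hne
  have h4 := hfix d' d hfst.symm hne.symm
  have h5 : H.rot d ≠ H.rot d' := fun h => hne (H.rot.injective h)
  grind

/-- Two leaves with a common neighbour, one following the other in the rotation at this
neighbour, are consecutive in the perimeter circuit. -/
theorem leaf_finRotate_eq {d d' : H.S.Dart} (hrot : H.rot d = d') (hl : ¬ H.IsLeaf d.fst)
    (h' : H.IsLeaf d'.snd) {i : Fin H.k} (hi : (H.leaf i : H.T) = d.snd) :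
    (H.leaf (finRotate H.k i) : H.T) = d'.snd := by
  obtain ⟨c, hc, n, hn, hlast, hmid⟩ := H.leaf_next i
  have hleaf : H.IsLeaf d.symm.fst := by
    have := (H.leaf i).2
    rw [hi] at this
    exact this
  obtain rfl : c = d.symm := H.dart_eq_of_isLeaf hleaf (hc.trans hi)
  have hstep : H.rot d.symm.symm = d' := by rw [SimpleGraph.Dart.symm_symm, hrot]
  have hfst : d'.fst = d.fst := by rw [← hrot, H.rot_fst]
  have hsnd : (H.rot d'.symm).fst = d'.snd := H.rot_fst _
  -- The face trace from `leaf i` is at the common neighbour after one step, and at the other leaf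
  -- after two.
  obtain rfl | rfl | hn2 : n = 1 ∨ n = 2 ∨ 2 < n := by omega
  · exfalso
    apply hl
    simp only [Function.iterate_one, hstep, hfst] at hlast
    rw [hlast]
    exact (H.leaf _).2
  · rw [← hlast]
    simp only [Function.iterate_succ, Function.iterate_zero, Function.comp_apply, id, hstep, hsnd]
  · exfalso
    apply hmid 2 two_pos hn2
    simp only [Function.iterate_succ, Function.iterate_zero, Function.comp_apply, id, hstep, hsnd]
    exact h'

theorem exists_darts_to_consecutive_leaves : ∃ (d d' d'' : H.S.Dart) (i : Fin H.k),
    ¬ H.IsLeaf d.fst ∧ (d ≠ d' ∧ d'' ≠ d ∧ d'' ≠ d') ∧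
    (∀ x : H.S.Dart, x.fst = d.fst ↔ x = d ∨ x = d' ∨ x = d'') ∧
    d.snd = H.leaf i ∧ d'.snd = H.leaf (finRotate H.k i) := by
  have key : ∀ d d' : H.S.Dart, d ≠ d' → d.fst = d'.fst → ¬ H.IsLeaf d.fst → H.IsLeaf d.snd →
      H.IsLeaf d'.snd → H.rot d = d' → ∃ (d d' d'' : H.S.Dart) (i : Fin H.k),
      ¬ H.IsLeaf d.fst ∧ (d ≠ d' ∧ d'' ≠ d ∧ d'' ≠ d') ∧
      (∀ x : H.S.Dart, x.fst = d.fst ↔ x = d ∨ x = d' ∨ x = d'') ∧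
      d.snd = H.leaf i ∧ d'.snd = H.leaf (finRotate H.k i) := by
    intro d d' hne hfst hl h h' hrot
    obtain ⟨d'', hd, hd', hall⟩ := H.exists_third_dart hne hfst hl
    have hi : (H.leaf (H.leaf.symm ⟨d.snd, h⟩) : H.T) = d.snd := by rw [Equiv.apply_symm_apply]
    exact ⟨d, d', d'', H.leaf.symm ⟨d.snd, h⟩, hl, ⟨hne, hd, hd'⟩, hall, hi.symm,
      (H.leaf_finRotate_eq hrot hl h' hi).symm⟩
  obtain ⟨d, d', hne, hfst, hl, h, h'⟩ := H.exists_darts_to_leaves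
  rcases H.rot_eq_or_rot_eq hne hfst hl with hrot | hrot
  · exact key d d' hne hfst hl h h' hrot
  · exact key d' d hne.symm hfst.symm (hfst ▸ hl) h' h hrot

end CubicHalinGraph

/-! ### Transfer of flows from a graph to the multipole it arises from. -/

namespace Multipole

/-- A nowhere-zero flow on a graph that arises from a multipole by junctions gives a flow on the
multipole, which takes opposite values on free ends that are joined. -/
theorem YieldsByJunctions.exists_flow {M : Multipole.{u}} {J : M.End → M.End → Prop}
    {Γ : Multigraph.{u}} (h : M.YieldsByJunctions J Γ) {r : ℝ} (hΓ : Γ.HasNowhereZeroFlow r) :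
    ∃ ψ : M.End → ℝ, (∀ x, ψ (M.rev x) = -ψ x) ∧ (∀ x y, J x y → ψ y = -ψ x) ∧
      (∀ x, 1 ≤ |ψ x| ∧ |ψ x| ≤ r - 1) ∧
      ∀ (v : M.V) (ι : Type u) [Fintype ι] (f : ι → M.End), Function.Injective f →
        (∀ x, M.vert x = some v ↔ ∃ a, f a = x) → ∑ a, ψ (f a) = 0 := by
  classical
  obtain ⟨vtx, dir, hrev, hJ, hbase, huniq⟩ := h
  obtain ⟨φ, ⟨hφ, hK⟩, hb⟩ := hΓ
  -- The ends of a multipole carry no finiteness instance, so Kirchhoff's law is stated for every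
  -- finite enumeration of the ends at a vertex.
  refine ⟨fun x => φ (dir x), fun x => by simp only [hrev, hφ],
    fun x y hxy => by simp only [hJ x y hxy, hφ],
    fun x => hb _, fun v ι _ f hf hrange => ?_⟩
  have hvert : ∀ a, M.vert (f a) = some v := fun a => (hrange _).2 ⟨a, rfl⟩
  rw [← hK (vtx v)]
  refine Finset.sum_nbij (fun a => dir (f a)) ?_ ?_ ?_ fun _ _ => rfl
  · intro a _
    simpa using hbase _ _ (hvert a)
  · intro a _ b _ hab
    exact hf ((huniq (dir (f a))).unique ⟨by simp [hvert], rfl⟩ ⟨by simp [hvert], hab.symm⟩)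
  · intro d hd
    simp only [Finset.coe_filter, Finset.mem_univ, true_and, Set.mem_ofPred_eq] at hd
    obtain ⟨x, ⟨hx, rfl⟩, -⟩ := huniq d
    obtain ⟨w, hw⟩ := Option.ne_none_iff_exists'.1 hx
    rw [hbase x w hw] at hd
    obtain ⟨a, rfl⟩ := (hrange x).1 (by rw [hw, vtx.injective hd])
    exact ⟨a, by simp, rfl⟩

end Multipole

/-! ### Extension by zero from a pole to the graph it was cut from. -/

namespace Multigraph

variable {G : Multigraph.{u}}

/-- Extend by zero a function on the ends of the retained edges. -/
noncomputable def extend (F : Set G.D) (θ : {x : G.D // x ∉ F} → ℝ) : G.D → ℝ :=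
  Function.extend Subtype.val θ 0

theorem extend_of_notMem {F : Set G.D} (θ : {x : G.D // x ∉ F} → ℝ) {x : G.D} (hx : x ∉ F) :
    extend F θ x = θ ⟨x, hx⟩ :=
  Subtype.val_injective.extend_apply θ 0 ⟨x, hx⟩

theorem extend_of_mem {F : Set G.D} (θ : {x : G.D // x ∉ F} → ℝ) {x : G.D} (hx : x ∈ F) :
    extend F θ x = 0 :=
  Function.extend_apply' _ _ _ (by rintro ⟨y, rfl⟩; exact y.2 hx)

theorem extend_rev {P : Set G.V} {F : Set G.D} (hF : ∀ x ∈ F, G.rev x ∈ F)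
    {θ : {x : G.D // x ∉ F} → ℝ} (h : ∀ x, θ ((G.remove P F hF).rev x) = -θ x) (x : G.D) :
    extend F θ (G.rev x) = -extend F θ x := by
  by_cases hx : x ∈ F
  · rw [extend_of_mem θ hx, extend_of_mem θ (hF x hx), neg_zero]
  · have hx' : G.rev x ∉ F := fun h' => hx (by simpa [G.rev_rev] using hF _ h')
    rw [extend_of_notMem θ hx, extend_of_notMem θ hx']
    exact h ⟨x, hx⟩

-- Removed ends contribute zero. At a removed vertex the outflow is thus the total over its
-- connector, which lets connectors be handled as vertices of the original graph.
open scoped Classical in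
theorem outflow_extend (F : Set G.D) (θ : {x : G.D // x ∉ F} → ℝ) (w : G.V) :
    G.outflow (extend F θ) w = ∑ x : {x : G.D // x ∉ F ∧ G.base x = w}, θ ⟨x, x.2.1⟩ := by
  rw [outflow, ← Finset.sum_filter_add_sum_filter_not _ (fun x => x ∈ F),
    Finset.sum_eq_zero fun x hx => extend_of_mem θ (Finset.mem_filter.1 hx).2, zero_add,
    Finset.sum_subtype (p := fun x => x ∉ F ∧ G.base x = w) _ (by simp [and_comm])]
  exact Finset.sum_congr rfl fun x _ => extend_of_notMem θ x.2.1

theorem remove_vert_eq_some {P : Set G.V} {F : Set G.D} (hF : ∀ x ∈ F, G.rev x ∈ F)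
    (x : {x : G.D // x ∉ F}) (w : {w : G.V // w ∉ P}) :
    (G.remove P F hF).vert x = some w ↔ G.base x = w := by
  have hw := w.2
  simp only [remove]
  split_ifs with h
  · exact ⟨fun h' => by simp at h', fun h' => absurd (h' ▸ h) hw⟩
  · rw [Option.some_inj, Subtype.ext_iff]

theorem circularFlowNumber_lt {c : ℝ} (h : G.circularFlowNumber < c) :
    ∃ r, 2 ≤ r ∧ r < c ∧ G.HasNowhereZeroFlow r := by
  simp only [circularFlowNumber, iInf_lt_iff, EReal.coe_lt_coe_iff] at h
  obtain ⟨r, ⟨h2, hf⟩, hr⟩ := h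
  exact ⟨r, h2, hr, hf⟩

theorem not_hasNowhereZeroFlow {c r : ℝ} (h : c ≤ G.circularFlowNumber) (h2 : 2 ≤ r)
    (hr : r < c) : ¬ G.HasNowhereZeroFlow r := fun hf =>
  absurd (h.trans (iInf₂_le r ⟨h2, hf⟩)) (not_le.2 (EReal.coe_lt_coe_iff.2 hr))

end Multigraph

/-! ### The removed path in the bipartite graph. -/

namespace HalinFragment

variable (F : HalinFragment.{u})

/-- Bipartiteness excludes loops; this separates `w'` from `u'` and from `v'`. -/
theorem base_ne_base_rev_K (x : F.K.D) : F.K.base x ≠ F.K.base (F.K.rev x) := by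
  obtain ⟨c, hc⟩ := F.K_bipartite
  exact fun h => hc x (by rw [← h])

theorem exists_unique_residual : ∃ y : F.Residual, ∀ z, z = y := by
  classical
  have hcard : (Finset.univ.filter fun x => F.K.base x = F.K.base F.g).card = 3 := by
    rw [← F.K_cubic (F.K.base F.g), Nat.card_eq_fintype_card, Fintype.card_subtype]
  have hf : F.K.base F.f ≠ F.K.base F.g := F.path ▸ F.base_ne_base_rev_K F.f
  have hg := F.base_ne_base_rev_K F.g
  -- The path uses two distinct ends at `w'`, so exactly one of the three is left.
  have hne : F.K.rev F.f ≠ F.g := fun h => F.u'_ne_v' (by rw [← h, F.K.rev_rev])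
  have h1 : (((Finset.univ.filter fun x => F.K.base x = F.K.base F.g).erase
      (F.K.rev F.f)).erase F.g).card = 1 := by
    rw [Finset.card_erase_of_mem, Finset.card_erase_of_mem, hcard]
    · simp [F.path]
    · simp [hne.symm]
  obtain ⟨y, hy⟩ := Finset.card_eq_one.1 h1
  have hmem : ∀ z, (z ∉ F.removedK ∧ F.K.base z = F.K.base F.g) ↔ z = y := by
    intro z
    rw [← Finset.mem_singleton (b := z), ← hy]
    simp only [removedK, Set.mem_insert_iff, Set.mem_singleton_iff, Finset.mem_erase,
      Finset.mem_filter, Finset.mem_univ, true_and, not_or]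
    constructor
    · tauto
    · rintro ⟨h1, h2, h3⟩
      exact ⟨⟨fun h => hf (h ▸ h3), h2, h1, fun h => hg (h ▸ h3).symm⟩, h3⟩
  exact ⟨⟨y, (hmem y).2 rfl⟩, fun z => Subtype.ext ((hmem z).1 z.2)⟩

end HalinFragment

/-! ### Conservation of flow through the fragments and at the tree. -/

namespace HalinConstruction

variable {A : HalinConstruction.{u}}

/-- The restriction to the `i`-th decollineator, as a function on the graph it comes from. -/
noncomputable def restrictD (ψ : A.parts.End → ℝ) (i : Fin A.H.k) : (A.F i).G.D → ℝ :=
  Multigraph.extend (A.F i).removedG fun x => ψ (A.inD i x x.2)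

/-- The restriction to the `i`-th bipartite pole, as a function on the graph it comes from. -/
noncomputable def restrictB (ψ : A.parts.End → ℝ) (i : Fin A.H.k) : (A.F i).K.D → ℝ :=
  Multigraph.extend (A.F i).removedK fun y => ψ (A.inB i y y.2)

/-- The total flow through the `i`-th decollineator. -/
noncomputable def throughput (ψ : A.parts.End → ℝ) (i : Fin A.H.k) : ℝ :=
  (A.F i).G.outflow (restrictD ψ i) ((A.F i).G.base (A.F i).e)

variable {ψ : A.parts.End → ℝ}

theorem restrictD_rev (h : ∀ x, ψ (A.parts.rev x) = -ψ x) (i : Fin A.H.k) (x : (A.F i).G.D) :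
    restrictD ψ i ((A.F i).G.rev x) = -restrictD ψ i x :=
  -- The reversal in `remove` does not depend on the removed vertices, so `∅` serves as well.
  Multigraph.extend_rev (P := ∅) (by
    rintro x (rfl | rfl) <;> simp [HalinFragment.removedG, Multigraph.rev_rev])
    (fun ⟨x, hx⟩ => h (A.inD i x hx)) x

theorem restrictB_rev (h : ∀ x, ψ (A.parts.rev x) = -ψ x) (i : Fin A.H.k) (x : (A.F i).K.D) :
    restrictB ψ i ((A.F i).K.rev x) = -restrictB ψ i x :=
  Multigraph.extend_rev (P := ∅) (by
    rintro x (rfl | rfl | rfl | rfl) <;> simp [HalinFragment.removedK, Multigraph.rev_rev])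
    (fun ⟨x, hx⟩ => h (A.inB i x hx)) x

theorem outflow_restrictD
    (hK : ∀ (v : A.parts.V) (ι : Type u) [Fintype ι] (f : ι → A.parts.End),
      Function.Injective f → (∀ x, A.parts.vert x = some v ↔ ∃ a, f a = x) → ∑ a, ψ (f a) = 0)
    (i : Fin A.H.k) (w : (A.F i).G.V) (hu : w ≠ (A.F i).G.base (A.F i).e)
    (hv : w ≠ (A.F i).G.base ((A.F i).G.rev (A.F i).e)) :
    (A.F i).G.outflow (restrictD ψ i) w = 0 := by
  classical
  have hw : w ∉ ({(A.F i).G.base (A.F i).e, (A.F i).G.base ((A.F i).G.rev (A.F i).e)} :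
      Set (A.F i).G.V) := by simp [hu, hv]
  rw [restrictD, Multigraph.outflow_extend]
  refine hK (Sum.inl ⟨i, ⟨w, hw⟩⟩) _ (fun x : {x // x ∉ (A.F i).removedG ∧ (A.F i).G.base x = w} =>
    A.inD i x.1 x.2.1) ?_ ?_
  · intro x y hxy
    have h := eq_of_heq (Sigma.mk.inj (Sum.inl_injective hxy)).2
    exact Subtype.ext (Subtype.mk.inj h)
  · rintro (⟨j, x⟩ | x)
    · constructor
      · intro h
        obtain ⟨y, hy, hy'⟩ := Option.map_eq_some_iff.1 h
        obtain ⟨z, hz, rfl⟩ := Option.map_eq_some_iff.1 hy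
        have hj := Sum.inl_injective hy'
        obtain rfl : j = i := congrArg Sigma.fst hj
        obtain rfl := eq_of_heq (Sigma.mk.inj hj).2
        exact ⟨⟨x.1, x.2, (Multigraph.remove_vert_eq_some _ x _).1 hz⟩, rfl⟩
      · rintro ⟨y, hy⟩
        cases hy
        exact Option.map_eq_some_iff.2 ⟨_, Option.map_eq_some_iff.2
          ⟨⟨w, hw⟩, (Multigraph.remove_vert_eq_some _ _ _).2 y.2.2, rfl⟩, rfl⟩
    · constructor
      · intro h
        obtain ⟨y, -, hy'⟩ := Option.map_eq_some_iff.1 h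
        cases hy'
      · rintro ⟨y, hy⟩
        cases hy

theorem outflow_restrictB
    (hK : ∀ (v : A.parts.V) (ι : Type u) [Fintype ι] (f : ι → A.parts.End),
      Function.Injective f → (∀ x, A.parts.vert x = some v ↔ ∃ a, f a = x) → ∑ a, ψ (f a) = 0)
    (i : Fin A.H.k) (w : (A.F i).K.V) (hu : w ≠ (A.F i).K.base (A.F i).f)
    (hg : w ≠ (A.F i).K.base (A.F i).g)
    (hv : w ≠ (A.F i).K.base ((A.F i).K.rev (A.F i).g)) :
    (A.F i).K.outflow (restrictB ψ i) w = 0 := by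
  classical
  have hw : w ∉ ({(A.F i).K.base (A.F i).f, (A.F i).K.base (A.F i).g,
      (A.F i).K.base ((A.F i).K.rev (A.F i).g)} : Set (A.F i).K.V) := by simp [hu, hg, hv]
  rw [restrictB, Multigraph.outflow_extend]
  refine hK (Sum.inr (Sum.inl ⟨i, ⟨w, hw⟩⟩)) _ (fun x : {x // x ∉ (A.F i).removedK ∧ (A.F i).K.base x = w} =>
    A.inB i x.1 x.2.1) ?_ ?_
  · intro x y hxy
    have h := eq_of_heq (Sigma.mk.inj (Sum.inl_injective (Sum.inr_injective hxy))).2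
    exact Subtype.ext (Subtype.mk.inj h)
  · rintro (x | ⟨j, x⟩ | x)
    · constructor
      · intro h
        obtain ⟨y, -, hy'⟩ := Option.map_eq_some_iff.1 h
        cases hy'
      · rintro ⟨y, hy⟩
        cases hy
    · constructor
      · intro h
        obtain ⟨y, hy, hy'⟩ := Option.map_eq_some_iff.1 h
        obtain ⟨z, hz, rfl⟩ := Option.map_eq_some_iff.1 hy
        obtain ⟨z', hz', rfl⟩ := Option.map_eq_some_iff.1 hz
        have hj := Sum.inl_injective (Sum.inr_injective hy')
        obtain rfl : j = i := congrArg Sigma.fst hj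
        obtain rfl := eq_of_heq (Sigma.mk.inj hj).2
        exact ⟨⟨x.1, x.2, (Multigraph.remove_vert_eq_some _ x _).1 hz'⟩, rfl⟩
      · rintro ⟨y, hy⟩
        cases hy
        exact Option.map_eq_some_iff.2 ⟨_, Option.map_eq_some_iff.2 ⟨_, Option.map_eq_some_iff.2
          ⟨⟨w, hw⟩, (Multigraph.remove_vert_eq_some _ _ _).2 y.2.2, rfl⟩, rfl⟩, rfl⟩
    · constructor
      · intro h
        obtain ⟨y, hy, hy'⟩ := Option.map_eq_some_iff.1 h
        obtain ⟨z, -, rfl⟩ := Option.map_eq_some_iff.1 hy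
        cases hy'
      · rintro ⟨y, hy⟩
        cases hy

/-- The value on the residual end of the `i`-th bipartite pole. -/
theorem residual_value (h : ∀ x, ψ (A.parts.rev x) = -ψ x)
    (hJ : ∀ x y, A.Junction x y → ψ y = -ψ x)
    (hK : ∀ (v : A.parts.V) (ι : Type u) [Fintype ι] (f : ι → A.parts.End),
      Function.Injective f → (∀ x, A.parts.vert x = some v ↔ ∃ a, f a = x) → ∑ a, ψ (f a) = 0)
    (i : Fin A.H.k) (y : (A.F i).Residual) :
    ψ (A.inB i y y.2.1) = throughput ψ (finRotate A.H.k i) - throughput ψ i := by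
  classical
  -- Within each original graph the outflows sum to zero, and only the removed vertices can
  -- contribute.
  have hD : throughput ψ i +
      (A.F i).G.outflow (restrictD ψ i) ((A.F i).G.base ((A.F i).G.rev (A.F i).e)) = 0 := by
    rw [← Multigraph.sum_outflow_univ (restrictD_rev h i),
      Fintype.sum_eq_add _ _ (A.F i).u_ne_v fun w hw => outflow_restrictD hK i w hw.1 hw.2]
    rfl
  have hB : (A.F i).K.outflow (restrictB ψ i) ((A.F i).K.base (A.F i).f) +
      ((A.F i).K.outflow (restrictB ψ i) ((A.F i).K.base (A.F i).g) +
      (A.F i).K.outflow (restrictB ψ i) ((A.F i).K.base ((A.F i).K.rev (A.F i).g))) = 0 := by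
    have hfg : (A.F i).K.base (A.F i).f ≠ (A.F i).K.base (A.F i).g :=
      (A.F i).path ▸ (A.F i).base_ne_base_rev_K (A.F i).f
    rw [← Multigraph.sum_outflow_univ (restrictB_rev h i),
      ← Finset.sum_subset (Finset.subset_univ {(A.F i).K.base (A.F i).f,
        (A.F i).K.base (A.F i).g, (A.F i).K.base ((A.F i).K.rev (A.F i).g)}) (fun w _ hw => by
          simp only [Finset.mem_insert, Finset.mem_singleton, not_or] at hw
          exact outflow_restrictB hK i w hw.1 hw.2.1 hw.2.2),
      Finset.sum_insert, Finset.sum_pair ((A.F i).base_ne_base_rev_K _)]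
    simp [hfg, (A.F i).u'_ne_v']
  -- Joined connectors carry opposite totals, whichever way their ends are matched.
  have hin : (A.F i).K.outflow (restrictB ψ i) ((A.F i).K.base (A.F i).f) =
      -(A.F i).G.outflow (restrictD ψ i) ((A.F i).G.base ((A.F i).G.rev (A.F i).e)) := by
    rw [restrictB, restrictD, Multigraph.outflow_extend, Multigraph.outflow_extend,
      ← Finset.sum_neg_distrib]
    symm
    let join : (A.F i).MiddleOut ≃
      {y // y ∉ (A.F i).removedK ∧ (A.F i).K.base y = (A.F i).K.base (A.F i).f} := (A.F i).join
    refine Fintype.sum_equiv join _ _ fun x => ?_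
    exact (hJ _ _ (Junction.fragment i x)).symm
  have hout : throughput ψ (finRotate A.H.k i) =
      -(A.F i).K.outflow (restrictB ψ i) ((A.F i).K.base ((A.F i).K.rev (A.F i).g)) := by
    rw [throughput, restrictB, restrictD, Multigraph.outflow_extend, Multigraph.outflow_extend,
      ← Finset.sum_neg_distrib]
    symm
    refine Fintype.sum_equiv (A.join i) _ _ fun x => ?_
    exact (hJ _ _ (Junction.perimeter i x)).symm
  have hres : (A.F i).K.outflow (restrictB ψ i) ((A.F i).K.base (A.F i).g) =
      ψ (A.inB i y y.2.1) := by
    obtain ⟨z, hz⟩ := (A.F i).exists_unique_residual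
    rw [restrictB, Multigraph.outflow_extend]
    exact Fintype.sum_eq_single y fun w hw => absurd ((hz w).trans (hz y).symm) hw
  linarith

/-- The junction with the residual end and the reversal of the dart each change the sign, so the
dart towards the leaf carries exactly the residual value. -/
theorem inS_value (h : ∀ x, ψ (A.parts.rev x) = -ψ x)
    (hJ : ∀ x y, A.Junction x y → ψ y = -ψ x)
    (hK : ∀ (v : A.parts.V) (ι : Type u) [Fintype ι] (f : ι → A.parts.End),
      Function.Injective f → (∀ x, A.parts.vert x = some v ↔ ∃ a, f a = x) → ∑ a, ψ (f a) = 0)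
    {i : Fin A.H.k} {d : A.H.S.Dart} (hd : d.snd = A.H.leaf i) :
    ψ (A.inS d) = throughput ψ (finRotate A.H.k i) - throughput ψ i := by
  obtain ⟨y, -⟩ := (A.F i).exists_unique_residual
  have h1 := hJ _ _ (Junction.residual i y d.symm hd)
  have h2 : ψ (A.inS d.symm) = -ψ (A.inS d) := h (A.inS d)
  rw [← residual_value h hJ hK i y]
  linarith

theorem sum_inS
    (hK : ∀ (v : A.parts.V) (ι : Type u) [Fintype ι] (f : ι → A.parts.End),
      Function.Injective f → (∀ x, A.parts.vert x = some v ↔ ∃ a, f a = x) → ∑ a, ψ (f a) = 0)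
    {d d' d'' : A.H.S.Dart} (hl : ¬ A.H.IsLeaf d.fst) (hne : d ≠ d' ∧ d'' ≠ d ∧ d'' ≠ d')
    (hall : ∀ x : A.H.S.Dart, x.fst = d.fst ↔ x = d ∨ x = d' ∨ x = d'') :
    ψ (A.inS d) + (ψ (A.inS d') + ψ (A.inS d'')) = 0 := by
  classical
  have hfin : ∀ x : A.H.S.Dart, x ∈ ({d, d', d''} : Finset A.H.S.Dart) ↔ x.fst = d.fst := by
    simp [hall]
  have := hK (Sum.inr (Sum.inr ⟨d.fst, hl⟩)) {x // x ∈ ({d, d', d''} : Finset A.H.S.Dart)}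
    (fun x => A.inS x.1) ?_ ?_
  · rw [← this, Finset.sum_coe_sort ({d, d', d''} : Finset A.H.S.Dart) fun x => ψ (A.inS x),
      Finset.sum_insert, Finset.sum_pair hne.2.2.symm]
    simp [hne.1, hne.2.1.symm]
  · intro x y hxy
    exact Subtype.ext (Sum.inr_injective (Sum.inr_injective hxy))
  · have hvert : ∀ x : A.H.S.Dart, A.H.innerTree.vert x = some ⟨d.fst, hl⟩ ↔ x.fst = d.fst := by
      intro x
      simp only [CubicHalinGraph.innerTree]
      split_ifs with hx
      · exact ⟨fun h' => by simp at h', fun h' => absurd (h' ▸ hx) hl⟩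
      · rw [Option.some_inj, Subtype.mk.injEq]
    rintro (x | x | x)
    · constructor
      · intro h
        obtain ⟨y, -, hy'⟩ := Option.map_eq_some_iff.1 h
        cases hy'
      · rintro ⟨y, hy⟩
        cases hy
    · constructor
      · intro h
        obtain ⟨y, hy, hy'⟩ := Option.map_eq_some_iff.1 h
        obtain ⟨z, -, rfl⟩ := Option.map_eq_some_iff.1 hy
        cases hy'
      · rintro ⟨y, hy⟩
        cases hy
    · constructor
      · intro h
        obtain ⟨y, hy, hy'⟩ := Option.map_eq_some_iff.1 h
        obtain ⟨z, hz, rfl⟩ := Option.map_eq_some_iff.1 hy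
        obtain rfl := Sum.inr_injective (Sum.inr_injective hy')
        exact ⟨⟨x, (hfin x).2 ((hvert x).1 hz)⟩, rfl⟩
      · rintro ⟨y, hy⟩
        obtain rfl := Sum.inr_injective (Sum.inr_injective hy)
        exact Option.map_eq_some_iff.2 ⟨_, Option.map_eq_some_iff.2
          ⟨_, (hvert _).2 ((hfin _).1 y.2), rfl⟩, rfl⟩

end HalinConstruction

/-! ### Arithmetic modulo `r` and the conclusion. -/

/-- A nonzero multiple of `r` has absolute value at least `r`, while `z` has at most `r - 1`. -/
theorem one_le_abs_sub_int_mul {r z : ℝ} (h1 : 1 ≤ |z|) (h2 : |z| ≤ r - 1) (m : ℤ) :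
    1 ≤ |z - m * r| := by
  rcases eq_or_ne m 0 with rfl | hm
  · simpa using h1
  · have h3 : (1 : ℝ) ≤ |(m : ℝ)| := by exact_mod_cast Int.one_le_abs hm
    have hr : 0 < r := by linarith
    have h4 : r ≤ |(m : ℝ) * r| := by
      rw [abs_mul, abs_of_pos hr]
      nlinarith
    have h5 := abs_sub_abs_le_abs_sub ((m : ℝ) * r) z
    rw [abs_sub_comm]
    linarith

theorem theorem9p1 (A : HalinConstruction.{u}) (Γ : Multigraph.{u}) (hΓ : A.Yields Γ)
    (hsnark : ∀ i, (A.F i).G.IsSnark)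
    (hflow : ∀ i, 5 ≤ (A.F i).G.circularFlowNumber) :
    5 ≤ Γ.circularFlowNumber := by
  by_contra hlt
  obtain ⟨r, h2, h5, hf⟩ := Multigraph.circularFlowNumber_lt (c := 5) (not_le.1 hlt)
  obtain ⟨ψ, hrev, hJ, hb, hK⟩ := Multipole.YieldsByJunctions.exists_flow hΓ hf
  have hthrough : ∀ i, ∃ m : ℤ, |HalinConstruction.throughput ψ i - m * r| < 1 := fun i =>
    Multigraph.exists_abs_outflow_sub_lt_one (hsnark i).1 (A.F i).u_ne_v h2
      (Multigraph.not_hasNowhereZeroFlow (c := 5) (hflow i) h2 h5)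
      (HalinConstruction.restrictD_rev hrev i)
      (Multigraph.extend_of_mem _ (by simp [HalinFragment.removedG]))
      (fun x hx hx' => by
        rw [HalinConstruction.restrictD, Multigraph.extend_of_notMem _
          (show x ∉ (A.F i).removedG by simp [HalinFragment.removedG, hx, hx'])]
        exact hb _)
      (HalinConstruction.outflow_restrictD hK i)
  obtain ⟨d, d', d'', i, hl, hne, hall, hd, hd'⟩ := A.H.exists_darts_to_consecutive_leaves
  have hsum := HalinConstruction.sum_inS hK hl hne hall
  have hv := HalinConstruction.inS_value hrev hJ hK hd
  have hv' := HalinConstruction.inS_value hrev hJ hK hd'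
  obtain ⟨m₀, h₀⟩ := hthrough i
  obtain ⟨m₁, h₁⟩ := hthrough (finRotate A.H.k i)
  obtain ⟨m₂, h₂⟩ := hthrough (finRotate A.H.k (finRotate A.H.k i))
  -- These multipliers turn the three edge values into the differences of the reduced totals `X - m
  -- * r`.
  have k₁ := one_le_abs_sub_int_mul (hb (A.inS d)).1 (hb _).2 (m₁ - m₀)
  have k₂ := one_le_abs_sub_int_mul (hb (A.inS d')).1 (hb _).2 (m₂ - m₁)
  have k₃ := one_le_abs_sub_int_mul (hb (A.inS d'')).1 (hb _).2 (m₀ - m₂)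
  have hv'' : ψ (A.inS d'') = -(ψ (A.inS d) + ψ (A.inS d')) := by linarith
  rw [hv'', hv, hv'] at k₃
  rw [hv] at k₁
  rw [hv'] at k₂
  push_cast at k₁ k₂ k₃
  rw [abs_lt] at h₀ h₁ h₂
  -- For each order of the three reduced totals, the outer two would be at least 2 apart inside (-1,
  -- 1); the two cyclic sign patterns contradict the differences summing to zero.
  rcases le_abs.1 k₁ with k₁ | k₁ <;> rcases le_abs.1 k₂ with k₂ | k₂ <;>
    rcases le_abs.1 k₃ with k₃ | k₃ <;> linarith
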